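/- \textbf{Conventions.} A \emph{tree} is a partial order $(T,<)$ in which the set of predecessors of every node is well-ordered; the \emph{height} of a node is the order type of its set of predecessors, the level $T_\alpha$ is the set of nodes of height $\alpha$, and the height of $T$ is the least $\alpha$ with $T_\alpha=\emptyset$. A tree is \emph{normal} if (a) it has a single minimal node, (b) each node $s$ with $\mathrm{ht}(s)+1<\mathrm{ht}(T)$ has at least two immediate successors, (c) each node has successors in every higher non-empty level, and (d) two nodes of limit height with the same predecessors are equal. It is \emph{$\aleph_0$-branching} if every node that has a successor has exactly $\aleph_0$ immediate successors. It satisfies the \emph{c.c.c.} if every set of pairwise incomparable nodes is countable. A \emph{Souslin tree} is a tree of height $\omega_1$ that satisfies the c.c.c. and all of whose branches (linearly ordered, downwards closed subsets) are countable. For $s\in T$ let $T(s)=\{t\in T: s\le t\}$, with the inherited order. The \emph{tree product} of trees $T^i$ ($i\in I$, $I\neq\emptyset$) of the same height $\mu$ is $\bigotimes_{i\in I}T^i=\bigcup_{\alpha<\mu}\prod_{i\in I}T^i_\alpha$, where $f<g$ if and only if $f(i)<g(i)$ for all $i\in I$. A Souslin tree $T$ is \emph{strongly homogeneous} if there is a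 family $(\psi_{st}: s,t\in T,\ \mathrm{ht}(s)=\mathrm{ht}(t))$ such that: (1) $\psi_{st}:T(s)\to T(t)$ is an isomorphism and $\psi_{ss}$ is the identity; (2) $\psi_{rt}=\psi_{st}\circ\psi_{rs}$ for all $r,s,t$ of the same height; (3) if $\mathrm{ht}(r)=\mathrm{ht}(s)$, $t\ge r$ and $u=\psi_{rs}(t)$, then $\psi_{tu}$ is the restriction of $\psi_{rs}$ to $T(t)$; (4) if $t,u$ have the same (nonzero) limit height $\alpha$, then there are $\gamma<\alpha$ and predecessors $r<t$, $s<u$ of height $\gamma$ with $\psi_{rs}(t)=u$. A normal tree $T$ of height $\omega_1$ is \emph{free} if for every finite non-empty set of (pairwise distinct) nodes $s_0,\dots,s_k$ of $T$ of the same height, the tree product $\bigotimes_{i=0}^{k}T(s_i)$ satisfies the c.c.c. \textbf{Theorem.} Let $n>1$ be a natural number and let $T$ be a normal, $\aleph_0$-branching, strongly homogeneous Souslin tree. Then there are normal, $\aleph_0$-branching, free Souslin trees $S_0,\dots,S_{n-1}$ such that $T\cong\bigotimes_{m<n}S_m$. -/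

import Mathlib

open scoped Ordinal Cardinal

universe u v

namespace SouslinTree

/-- A (set-theoretic) tree: a partial order in which the set of predecessors of every node is
well-ordered. -/
class IsTree (T : Type u) [PartialOrder T] : Prop where
  wo : ∀ t : T, IsWellOrder (Set.Iio t) (· < ·)

attribute [instance] IsTree.wo

/-- The height of a node: the order type of its set of predecessors. -/
noncomputable def height {T : Type u} [PartialOrder T] [IsTree T] (t : T) : Ordinal.{u} :=
  Ordinal.type (α := Set.Iio t) (· < ·)

/-- The level `T_α`: all nodes of height `α`. -/
def level (T : Type u) [PartialOrder T] [IsTree T] (α : Ordinal.{u}) : Set T :=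
  {t | height t = α}

/-- The height of a tree: the least `α` such that the level `T_α` is empty. -/
noncomputable def treeHeight (T : Type u) [PartialOrder T] [IsTree T] : Ordinal.{u} :=
  sInf {α | level T α = ∅}

/-- The infimum defining `treeHeight` is attained, so no junk value occurs. -/
theorem level_treeHeight (T : Type u) [PartialOrder T] [IsTree T] :
    level T (treeHeight T) = ∅ := by
  have h : {α : Ordinal.{u} | level T α = ∅}.Nonempty := by
    refine ⟨Order.succ (⨆ t : T, height t), ?_⟩
    refine Set.eq_empty_iff_forall_notMem.2 fun t ht => ?_
    have h1 : height t ≤ ⨆ t : T, height t := Ordinal.le_iSup _ t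
    have h2 : height t = Order.succ (⨆ t : T, height t) := ht
    exact absurd (Order.lt_succ (⨆ t : T, height t)) (not_lt.2 (h2 ▸ h1))
  exact csInf_mem h

/-- The part `T(s) = {t ∣ s ≤ t}` of a tree above a node `s` is a tree. -/
instance (T : Type u) [PartialOrder T] [IsTree T] (s : T) : IsTree (Set.Ici s) where
  wo t := by
    let f : ((· < ·) : Set.Iio t → Set.Iio t → Prop) ↪r
        ((· < ·) : Set.Iio (t : T) → Set.Iio (t : T) → Prop) :=
      { toFun := fun x => ⟨(x : Set.Ici s), x.2⟩
        inj' := fun x y h => Subtype.ext (Subtype.ext (Subtype.mk.inj h))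
        map_rel_iff' := Iff.rfl }
    exact f.isWellOrder

/-- Heights strictly increase along the tree order. -/
theorem height_strictMono {T : Type u} [PartialOrder T] [IsTree T] : StrictMono (height (T := T)) := by
  intro s t h
  let f : PrincipalSeg ((· < ·) : Set.Iio s → Set.Iio s → Prop)
      ((· < ·) : Set.Iio t → Set.Iio t → Prop) :=
    { toFun := fun x => ⟨x, lt_trans x.2 h⟩
      inj' := fun x y h => Subtype.ext (Subtype.mk.inj h)
      map_rel_iff' := Iff.rfl
      top := ⟨s, h⟩
      mem_range_iff_rel' := by
        intro b
        exact ⟨by rintro ⟨x, rfl⟩; exact x.2, fun hb => ⟨⟨b, hb⟩, rfl⟩⟩ }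
  exact f.ordinal_type_lt

/-- `T` is `κ`-branching: every node that is not a leaf has exactly `κ` immediate successors. -/
def IsBranching (T : Type u) [PartialOrder T] (κ : Cardinal.{u}) : Prop :=
  ∀ s : T, ¬ IsMax s → #{t : T // s ⋖ t} = κ

/-- Normal trees. -/
structure IsNormal (T : Type u) [PartialOrder T] [IsTree T] : Prop where
  /-- there is a single minimal node -/
  root : ∃! r : T, IsMin r
  /-- nodes below the top level have at least two immediate successors -/
  splits : ∀ s : T, height s + 1 < treeHeight T → ∃ t u : T, s ⋖ t ∧ s ⋖ u ∧ t ≠ u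
  /-- every node has successors in every higher non-empty level -/
  extends_up : ∀ (s : T) (α : Ordinal.{u}), height s < α → (level T α).Nonempty →
    ∃ t ∈ level T α, s < t
  /-- nodes of limit height are determined by their predecessors -/
  unique_limits : ∀ s t : T, Order.IsSuccLimit (height s) → Order.IsSuccLimit (height t) →
    Set.Iio s = Set.Iio t → s = t

/-- The countable chain condition for a tree: every set of pairwise incomparable nodes is
countable. -/
def IsCCC (T : Type u) [PartialOrder T] : Prop :=
  ∀ A : Set T, IsAntichain (· ≤ ·) A → A.Countable

/-- A branch: a linearly ordered, downwards closed set of nodes. -/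
def IsBranch {T : Type u} [PartialOrder T] (b : Set T) : Prop :=
  IsChain (· ≤ ·) b ∧ IsLowerSet b

/-- Souslin trees: height `ω₁`, all antichains and all branches are countable. -/
structure IsSouslin (T : Type u) [PartialOrder T] [IsTree T] : Prop where
  height_eq : treeHeight T = ω₁
  ccc : IsCCC T
  countable_branch : ∀ b : Set T, IsBranch b → b.Countable

/-- The tree product `⨂ᵢ Tᵢ = ⋃_α ∏ᵢ (Tᵢ)_α` of a family of trees. -/
def TreeProd {ι : Type v} (T : ι → Type u) [∀ i, PartialOrder (T i)] [∀ i, IsTree (T i)] :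
    Type (max u v) :=
  {f : ∀ i, T i // ∃ α : Ordinal.{u}, ∀ i, f i ∈ level (T i) α}

/-- The tree product is ordered coordinatewise. -/
instance {ι : Type v} (T : ι → Type u) [∀ i, PartialOrder (T i)] [∀ i, IsTree (T i)] :
    PartialOrder (TreeProd T) :=
  inferInstanceAs (PartialOrder {f : ∀ i, T i // ∃ α : Ordinal.{u}, ∀ i, f i ∈ level (T i) α})

/-- The strict order of a tree product of a nonempty family is the conjunction of the strict orders
of the factors. -/
theorem TreeProd.lt_iff {ι : Type v} [Nonempty ι] (T : ι → Type u) [∀ i, PartialOrder (T i)]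
    [∀ i, IsTree (T i)] (f g : TreeProd T) : f < g ↔ ∀ i, f.1 i < g.1 i := by
  obtain ⟨f, α, hf⟩ := f
  obtain ⟨g, β, hg⟩ := g
  change f < g ↔ ∀ i, f i < g i
  rw [Pi.lt_def]
  constructor
  · rintro ⟨hle, j, hj⟩ i
    refine lt_of_le_of_ne (hle i) fun hi => ?_
    have h1 := height_strictMono hj
    have h2 : height (f i) = height (g i) := by rw [hi]
    have e1 : height (f i) = α := hf i
    have e2 : height (g i) = β := hg i
    have e3 : height (f j) = α := hf j
    have e4 : height (g j) = β := hg j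
    rw [e3, e4, ← e1, ← e2, h2] at h1
    exact lt_irrefl _ h1
  · intro h
    exact ⟨fun i => (h i).le, Classical.arbitrary ι, h _⟩

/-- A coherent family `(ψ_{st} ∣ s, t ∈ T, ht s = ht t)` of tree isomorphisms on `T`. -/
structure CoherentFamily (T : Type u) [PartialOrder T] [IsTree T] where
  /-- `ψ_{st} : T(s) ≅ T(t)` -/
  ψ : ∀ s t : T, height s = height t → (Set.Ici s ≃o Set.Ici t)
  ψ_self : ∀ s : T, ψ s s rfl = OrderIso.refl _
  /-- `ψ_{rt} = ψ_{st} ∘ ψ_{rs}` -/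
  commutativity : ∀ (r s t : T) (hrs : height r = height s) (hst : height s = height t),
    ψ r t (hrs.trans hst) = (ψ r s hrs).trans (ψ s t hst)
  /-- If `u = ψ_{rs}(t)`, then `ψ_{tu}` is the restriction of `ψ_{rs}` to `T(t)`. (The equation
  `ht t = ht u` holds automatically, as `ψ_{rs}` is an isomorphism and `ht r = ht s`.) -/
  coherence : ∀ (r s : T) (hrs : height r = height s) (t u : T) (htu : height t = height u)
    (hrt : r ≤ t) (hsu : s ≤ u), ψ r s hrs ⟨t, hrt⟩ = ⟨u, hsu⟩ →
    ∀ (x : T) (hx : t ≤ x), (ψ t u htu ⟨x, hx⟩ : T) = ψ r s hrs ⟨x, hrt.trans hx⟩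
  /-- If `t`, `u` lie on the same limit level, then for their predecessors `r`, `s` on some lower
  level, `ψ_{rs}(t) = u`. -/
  transitivity : ∀ t u : T, height t = height u → Order.IsSuccLimit (height t) →
    ∃ (r s : T) (hrs : height r = height s) (hrt : r < t) (_ : s < u),
      (ψ r s hrs ⟨t, hrt.le⟩ : T) = u

/-- Strong homogeneity (of a Souslin tree): there is a coherent family. -/
def IsStronglyHomogeneous (T : Type u) [PartialOrder T] [IsTree T] : Prop :=
  Nonempty (CoherentFamily T)

/-- Free trees: normal trees of height `ω₁` such that for all finite nonempty sets `{s₀, …, s_k}` of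
nodes of the same height, the tree product of the `T(s_i)` satisfies the c.c.c. -/
structure IsFree (T : Type u) [PartialOrder T] [IsTree T] : Prop where
  normal : IsNormal T
  height_eq : treeHeight T = ω₁
  ccc_prod : ∀ (k : ℕ) (s : Fin (k + 1) → T), Function.Injective s →
    (∀ i j, height (s i) = height (s j)) → IsCCC (TreeProd fun i => Set.Ici (s i))

end SouslinTree

/-! Each factor is a quotient of `T`. Strong homogeneity lets the immediate successors of every node
be labelled by natural numbers so that all maps ψ preserve labels. Given partitions `p j` of ℕ, a
quotient is built level by level: every class gets a code `j`, distinct classes of one level get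
distinct codes, and successors of a class with code `j` are identified when their labels lie in the
same piece of `p j`. At limits, nodes are identified when all their restrictions are.

The quotients use the rows of an `n` by ω matrix of partitions with two properties. Pieces from one
partition in each row meet in exactly one point, so the classes of a node in the `n` quotients
determine it and can be prescribed freely; hence `T` is the product of the quotients. Partitions
within one row are independent, so above finitely many distinct nodes of one level of a quotient,
all successor choices can be realised at once by translates of a single node of `T`. The product of
the corresponding cones then maps into `T` by an order-reflecting map and inherits the c.c.c., which
is freeness.

Both arguments rest on `exists_common_lift`. Its successor step is the property of the matrix; its
limit step uses that finitely many nodes of a limit level are translates of one another from a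
common lower level on. -/

namespace SouslinTree

/-! ### The matrix of partitions, from linear algebra over ℤ -/

/-- If `N` lowers an exhaustive filtration starting at `⊥`, then `1 + N` is bijective. -/
theorem bijective_add_of_lowers {V : Type*} [AddCommGroup V] (N : V →+ V)
    (F : ℕ → AddSubgroup V) (h0 : F 0 = ⊥) (hF : ∀ x, ∃ k, x ∈ F k)
    (hN : ∀ k, ∀ x ∈ F (k + 1), N x ∈ F k) : Function.Bijective fun x => x + N x := by
  constructor
  · intro x y hxy
    have key : ∀ k, ∀ z ∈ F k, z + N z = 0 → z = 0 := by
      intro k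
      induction k with
      | zero => intro z hz _; simpa [h0] using hz
      | succ k ih =>
        intro z hz h
        refine ih z ?_ h
        rw [eq_neg_of_add_eq_zero_left h]
        exact (F k).neg_mem (hN k z hz)
    obtain ⟨k, hk⟩ := hF (x - y)
    refine sub_eq_zero.1 (key k _ hk ?_)
    have hxy' : x + N x = y + N y := hxy
    rw [map_sub, sub_add_sub_comm, hxy', sub_self]
  · have key : ∀ k, ∀ z ∈ F k, ∃ x, x + N x = z := by
      intro k
      induction k with
      | zero => intro z hz; exact ⟨0, by simpa [h0, eq_comm] using hz⟩
      | succ k ih =>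
        intro z hz
        obtain ⟨x, hx⟩ := ih _ (hN k z hz)
        -- With `x + N x = N z`, linearity gives `(z - x) + N (z - x) = z`.
        refine ⟨z - x, ?_⟩
        rw [map_sub, ← hx]; abel
    intro z
    obtain ⟨k, hk⟩ := hF z
    exact key k z hk

/-- There is an independent family of linear endomorphisms of `ℕ →₀ ℤ` that lower degrees. -/
theorem exists_independent_lowering :
    ∃ A : ℕ → (ℕ →₀ ℤ) →ₗ[ℤ] (ℕ →₀ ℤ),
      (∀ j k, ∀ x ∈ Finsupp.supported ℤ ℤ (Set.Iio (k + 1)),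
        A j x ∈ Finsupp.supported ℤ ℤ (Set.Iio k)) ∧
      ∀ (s : Finset ℕ) (w : ℕ → ℕ →₀ ℤ), ∃ x, ∀ j ∈ s, A j x = w j := by
  classical
  -- The second component of `g k` is a finite table of desired values; the idle first component
  -- makes each table occur for infinitely many `k`.
  obtain ⟨g, hg⟩ := exists_surjective_nat (ℕ × (ℕ →₀ (ℕ →₀ ℤ)))
  -- `a j k` is the image of the `k`-th basis vector under `A j`: the value in table `k`, replaced
  -- by 0 when its degree is too large for `A j` to lower degrees.
  let a : ℕ → ℕ → (ℕ →₀ ℤ) := fun j k =>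
    if (g k).2 j ∈ Finsupp.supported ℤ ℤ (Set.Iio k) then (g k).2 j else 0
  have ha : ∀ j k, a j k ∈ Finsupp.supported ℤ ℤ (Set.Iio k) := by
    intro j k
    by_cases h : (g k).2 j ∈ Finsupp.supported ℤ ℤ (Set.Iio k)
    · simpa only [a, if_pos h] using h
    · simp only [a, if_neg h, Submodule.zero_mem]
  refine ⟨fun j => Finsupp.linearCombination ℤ (a j), ?_, ?_⟩
  · intro j k x hx
    have h1 : Finsupp.linearCombination ℤ (a j) x ∈
        Submodule.span ℤ (a j '' Set.Iio (k + 1)) := by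
      rw [Finsupp.span_image_eq_map_linearCombination]
      exact Submodule.mem_map_of_mem hx
    refine Submodule.span_le.2 ?_ h1
    rintro _ ⟨i, hi, rfl⟩
    exact Finsupp.supported_mono (Set.Iio_subset_Iio (Nat.lt_succ_iff.1 hi)) (ha j i)
  · intro s w
    let t : ℕ →₀ (ℕ →₀ ℤ) := Finsupp.onFinset s (fun j => if j ∈ s then w j else 0)
      (fun j hj => by by_contra h; simp [h] at hj)
    obtain ⟨N, hN⟩ : ∃ N, ∀ j ∈ s, w j ∈ Finsupp.supported ℤ ℤ (Set.Iio N) := by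
      refine ⟨(s.sup fun j => (w j).support.sup id) + 1, fun j hj => ?_⟩
      rw [Finsupp.mem_supported]
      intro i hi
      have h1 : i ≤ (w j).support.sup id := Finset.le_sup (f := id) hi
      have h2 := Finset.le_sup (f := fun j => (w j).support.sup id) hj
      exact Nat.lt_succ_iff.2 (h1.trans h2)
    have hinf : {k | (g k).2 = t}.Infinite := by
      refine Set.Infinite.of_image (fun k => (g k).1) ?_
      refine Set.infinite_univ.mono fun i _ => ?_
      obtain ⟨k, hk⟩ := hg (i, t)
      exact ⟨k, by simp [hk], by simp [hk]⟩
    obtain ⟨k, hk, hNk⟩ := hinf.exists_gt N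
    refine ⟨Finsupp.single k 1, fun j hj => ?_⟩
    have hk' : (g k).2 = t := hk
    have htj : t j = w j := by simp [t, hj]
    have := Finsupp.supported_mono (M := ℤ) (R := ℤ) (Set.Iio_subset_Iio hNk.le) (hN j hj)
    simp [a, hk', htj, this]

/-- An optimal matrix of partitions of `ℕ`: `p m j` is a partition of `ℕ` into pieces indexed by
`ℕ`. Pieces taken from one partition in each row meet in exactly one point, and different
partitions of the same row are independent. -/
theorem exists_optimal_matrix {ι : Type*} [Finite ι] [Nonempty ι] (σ : ι → ι)
    (hσ : ∀ m, σ m ≠ m) :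
    ∃ p : ι → ℕ → ℕ → ℕ,
      (∀ j : ι → ℕ, Function.Bijective fun i m => p m (j m) i) ∧
      ∀ m (s : Finset ℕ) (w : ℕ → ℕ), ∃ i, ∀ j ∈ s, p m j i = w j := by
  classical
  cases nonempty_fintype ι
  obtain ⟨A, hA, hind⟩ := exists_independent_lowering
  have : Denumerable (ℕ →₀ ℤ) := (nonempty_denumerable_iff.2 ⟨inferInstance, inferInstance⟩).some
  have : Denumerable (ι → ℕ →₀ ℤ) := (nonempty_denumerable_iff.2 ⟨inferInstance, inferInstance⟩).some
  let e := (Denumerable.eqv (ℕ →₀ ℤ))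
  let E := (Denumerable.eqv (ι → ℕ →₀ ℤ))
  -- The index `i` codes a vector `x`, and its piece is `x m + A j (x (σ m))`. A choice of one
  -- partition per row gives the map `1 + N` with `N` lowering degrees, hence a bijection.
  refine ⟨fun m j i => e (E.symm i m + A j (E.symm i (σ m))), fun j => ?_, fun m s w => ?_⟩
  · let N : (ι → ℕ →₀ ℤ) →+ (ι → ℕ →₀ ℤ) :=
      { toFun := fun x m => A (j m) (x (σ m))
        map_zero' := by ext; simp
        map_add' := fun x y => by ext; simp }
    let F : ℕ → AddSubgroup (ι → ℕ →₀ ℤ) := fun k =>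
      (Submodule.pi Set.univ fun _ : ι => Finsupp.supported ℤ ℤ (Set.Iio k)).toAddSubgroup
    have hFm : ∀ k x, x ∈ F k ↔ ∀ m, x m ∈ Finsupp.supported ℤ ℤ (Set.Iio k) := by
      intro k x; simp [F]
    have hb := bijective_add_of_lowers N F
      (by
        rw [eq_bot_iff]; intro x hx
        rw [hFm] at hx
        rw [AddSubgroup.mem_bot]
        funext m
        simpa [Finsupp.mem_supported] using hx m)
      (by
        intro x
        refine ⟨(Finset.univ.sup fun m => (x m).support.sup id) + 1, (hFm _ _).2 fun m => ?_⟩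
        rw [Finsupp.mem_supported]
        intro i hi
        have h1 : i ≤ (x m).support.sup id := Finset.le_sup (f := id) hi
        have h2 := Finset.le_sup (f := fun m => (x m).support.sup id) (Finset.mem_univ m)
        exact Nat.lt_succ_iff.2 (h1.trans h2))
      (by
        intro k x hx
        rw [hFm] at hx ⊢
        exact fun m => hA _ _ _ (hx _))
    exact ((Equiv.piCongrRight fun _ : ι => e).bijective.comp hb).comp E.symm.bijective
  · obtain ⟨x, hx⟩ := hind s fun j => e.symm (w j)
    -- Since `σ m ≠ m`, coordinate `m` of this vector vanishes and only `A j x` remains.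
    refine ⟨E (Pi.single (σ m) x), fun j hj => ?_⟩
    simp [Pi.single_eq_of_ne (hσ m).symm, hx j hj]

/-! ### Heights, restrictions and branches -/

section Basic

variable {T : Type u} [PartialOrder T] [IsTree T]

theorem le_total_of_le {x y z : T} (hy : y ≤ x) (hz : z ≤ x) : y ≤ z ∨ z ≤ y := by
  rcases hy.eq_or_lt with rfl | hy
  · exact Or.inr hz
  rcases hz.eq_or_lt with rfl | hz
  · exact Or.inl hy.le
  rcases trichotomous_of (α := Set.Iio x) (· < ·) ⟨y, hy⟩ ⟨z, hz⟩ with h | h | h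
  · exact Or.inl (le_of_lt h)
  · exact Or.inl (le_of_eq (congrArg Subtype.val h))
  · exact Or.inr (le_of_lt h)

theorem eq_of_le_of_height_eq {x y z : T} (hy : y ≤ x) (hz : z ≤ x)
    (h : height y = height z) : y = z := by
  rcases le_total_of_le hy hz with h' | h'
  · exact h'.eq_or_lt.resolve_right fun h1 => (height_strictMono h1).ne h
  · exact (h'.eq_or_lt.resolve_right fun h1 => (height_strictMono h1).ne h.symm).symm

theorem height_mono {x y : T} (h : x ≤ y) : height x ≤ height y :=
  height_strictMono.monotone h

theorem le_of_le_of_height_le {x y z : T} (hy : y ≤ x) (hz : z ≤ x)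
    (h : height y ≤ height z) : y ≤ z := by
  rcases le_total_of_le hy hz with h' | h'
  · exact h'
  · exact (eq_of_le_of_height_eq hy hz (h.antisymm (height_mono h'))).le

theorem lt_of_le_of_height_lt {x y : T} (hy : y ≤ x) (h : height y < height x) : y < x :=
  hy.lt_of_ne fun e => h.ne (congrArg height e)

theorem exists_le_height_eq (x : T) {β : Ordinal.{u}} (h : β ≤ height x) :
    ∃ y ≤ x, height y = β := by
  rcases h.eq_or_lt with rfl | h
  · exact ⟨x, le_rfl, rfl⟩
  obtain ⟨⟨s, hs⟩, rfl⟩ := Ordinal.typein_surj ((· < ·) : Set.Iio x → Set.Iio x → Prop) h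
  refine ⟨s, le_of_lt hs, ?_⟩
  let f : PrincipalSeg ((· < ·) : Set.Iio s → Set.Iio s → Prop)
      ((· < ·) : Set.Iio x → Set.Iio x → Prop) :=
    { toFun := fun y => ⟨y, lt_trans y.2 hs⟩
      inj' := fun y z h => Subtype.ext (Subtype.mk.inj h)
      map_rel_iff' := Iff.rfl
      top := ⟨s, hs⟩
      mem_range_iff_rel' := by
        intro b
        exact ⟨by rintro ⟨y, rfl⟩; exact y.2, fun hb => ⟨⟨b, hb⟩, rfl⟩⟩ }
  exact (Ordinal.typein_top f).symm

/-- The restriction of a node to level `β`: its unique predecessor of height `β`, or the node itself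
if its height is below `β`. -/
noncomputable def res (x : T) (β : Ordinal.{u}) : T :=
  open Classical in if h : β ≤ height x then (exists_le_height_eq x h).choose else x

theorem res_le (x : T) (β : Ordinal.{u}) : res x β ≤ x := by
  unfold res
  split_ifs with h
  · exact (exists_le_height_eq x h).choose_spec.1
  · exact le_rfl

theorem height_res {x : T} {β : Ordinal.{u}} (h : β ≤ height x) : height (res x β) = β := by
  rw [res, dif_pos h]
  exact (exists_le_height_eq x h).choose_spec.2

theorem res_eq {x y : T} {β : Ordinal.{u}} (h : y ≤ x) (hy : height y = β) : res x β = y :=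
  eq_of_le_of_height_eq (res_le x β) h
    ((height_res (hy ▸ height_mono h)).trans hy.symm)

theorem res_self {x : T} {β : Ordinal.{u}} (h : height x = β) : res x β = x := res_eq le_rfl h

theorem res_of_le {x y : T} {β : Ordinal.{u}} (h : y ≤ x) (hβ : β ≤ height y) :
    res x β = res y β :=
  res_eq ((res_le y β).trans h) (height_res hβ)

theorem res_lt {x : T} {β : Ordinal.{u}} (h : β < height x) : res x β < x :=
  lt_of_le_of_height_lt (res_le x β) (by rwa [height_res h.le])

theorem le_res {x y : T} {β : Ordinal.{u}} (h : y ≤ x) (hy : height y ≤ β) (hβ : β ≤ height x) :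
    y ≤ res x β :=
  le_of_le_of_height_le h (res_le x β) (by rwa [height_res hβ])

theorem covBy_iff_height {s t : T} : s ⋖ t ↔ s ≤ t ∧ height t = height s + 1 := by
  constructor
  · intro h
    refine ⟨h.le, ?_⟩
    have h1 : height s + 1 ≤ height t := Order.add_one_le_of_lt (height_strictMono h.lt)
    refine h1.eq_or_lt.elim Eq.symm fun h2 => ?_
    refine absurd (res_lt h2) (h.2 (lt_of_le_of_height_lt (le_res h.le ?_ h1) ?_))
    · exact (Order.lt_add_one_iff.2 le_rfl).le
    · rw [height_res h1]; exact Order.lt_add_one_iff.2 le_rfl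
  · rintro ⟨h, h1⟩
    refine ⟨lt_of_le_of_height_lt h (h1 ▸ Order.lt_add_one_iff.2 le_rfl), fun z hz hz' => ?_⟩
    have h2 := height_strictMono hz'
    rw [h1, Order.lt_add_one_iff] at h2
    exact absurd (height_strictMono hz) h2.not_gt

theorem res_covBy_res {x : T} {β : Ordinal.{u}} (h : β < height x) :
    res x β ⋖ res x (β + 1) := by
  have h1 := Order.add_one_le_of_lt h
  rw [covBy_iff_height, height_res h.le, height_res h1]
  refine ⟨le_res (res_le _ _) ?_ h1, rfl⟩
  rw [height_res h.le]; exact (Order.lt_add_one_iff.2 le_rfl).le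

theorem eq_of_height_eq_zero (hT : IsNormal T) {x y : T} (hx : height x = 0)
    (hy : height y = 0) : x = y := by
  have h : ∀ z : T, height z = 0 → IsMin z := fun z hz => by
    rw [isMin_iff_forall_not_lt]
    intro w hw
    exact absurd (height_strictMono hw) (by rw [hz]; exact not_lt_bot)
  exact hT.root.unique (h x hx) (h y hy)

/-- The predecessors of `x` are those of `s` followed by those of `x` inside `T(s)`. -/
theorem height_ici {s : T} (x : Set.Ici s) : height (x : T) = height s + height x := by
  let f : Sum.Lex ((· < ·) : Set.Iio s → Set.Iio s → Prop)
      ((· < ·) : Set.Iio x → Set.Iio x → Prop) ↪r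
      ((· < ·) : Set.Iio (x : T) → Set.Iio (x : T) → Prop) :=
    RelEmbedding.ofMonotone
      (Sum.elim (fun y => ⟨y, lt_of_lt_of_le y.2 x.2⟩) (fun y => ⟨y.1.1, y.2⟩)) (by
        rintro (a | a) (b | b) h
        · have h' := Sum.lex_inl_inl.1 h
          exact h'
        · have h' : (a : T) < b.1.1 := lt_of_lt_of_le a.2 b.1.2
          exact h'
        · exact absurd h Sum.lex_inr_inl
        · have h' := Sum.lex_inr_inr.1 h
          exact h')
  have hf : Function.Surjective f := by
    rintro ⟨y, hy⟩
    rcases le_total_of_le x.2 (le_of_lt hy) with h | h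
    · exact ⟨Sum.inr ⟨⟨y, h⟩, hy⟩, rfl⟩
    · rcases h.eq_or_lt with rfl | h
      · exact ⟨Sum.inr ⟨⟨y, le_rfl⟩, hy⟩, rfl⟩
      · exact ⟨Sum.inl ⟨y, h⟩, rfl⟩
  have := (RelIso.ofSurjective f hf).ordinalType_congr
  rw [Ordinal.type_sum_lex] at this
  exact this.symm

theorem height_orderIso {S : Type u} [PartialOrder S] [IsTree S] (e : T ≃o S) (x : T) :
    height (e x) = height x := by
  let f : ((· < ·) : Set.Iio x → Set.Iio x → Prop) ≃r
      ((· < ·) : Set.Iio (e x) → Set.Iio (e x) → Prop) :=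
    { toFun := fun y => ⟨e y, e.lt_iff_lt.2 y.2⟩
      invFun := fun y => ⟨e.symm y, by
        have h : (y : S) < e x := y.2
        simpa using (e.symm.lt_iff_lt.2 h)⟩
      left_inv := fun y => by simp
      right_inv := fun y => by simp
      map_rel_iff' := e.lt_iff_lt }
  exact f.ordinalType_congr.symm

theorem height_lt_treeHeight (x : T) : height x < treeHeight T := by
  by_contra! h
  have := level_treeHeight T
  exact Set.eq_empty_iff_forall_notMem.1 this (res x (treeHeight T)) (height_res h)

theorem height_add_one_lt (hT : treeHeight T = ω₁) (x : T) : height x + 1 < treeHeight T := by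
  have h := height_lt_treeHeight x
  rw [hT] at h ⊢
  exact (Cardinal.isSuccLimit_omega 1).add_one_lt h

theorem exists_gt (hT : treeHeight T = ω₁) (hN : IsNormal T) (x : T) : ∃ y, x < y := by
  obtain ⟨t, _, h, _, _⟩ := hN.splits x (height_add_one_lt hT x)
  exact ⟨t, h.lt⟩

theorem isAntichain_level (α : Ordinal.{u}) : IsAntichain (· ≤ ·) (level T α) :=
  fun _ hx _ hy hne h => hne (eq_of_le_of_height_eq h le_rfl (Eq.trans hx (Eq.symm hy)))

/-- In a normal tree of height `ω₁` with the countable chain condition all branches are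
countable. -/
theorem countable_branch_of_isCCC (hT : treeHeight T = ω₁) (hN : IsNormal T) (hccc : IsCCC T)
    (b : Set T) (hb : IsBranch b) : b.Countable := by
  -- A chain contains at most one of two immediate successors, so every node of `b` has one off `b`.
  have h1 : ∀ x : b, ∃ y, (x : T) ⋖ y ∧ y ∉ b := by
    intro x
    obtain ⟨t, t', h, h', hne⟩ := hN.splits (x : T) (height_add_one_lt hT x)
    by_contra! hc
    refine hne ?_
    rcases hb.1.total (hc t h) (hc t' h') with hle | hle
    · exact (hle.eq_or_lt).resolve_right fun hlt => h'.2 h.lt hlt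
    · exact ((hle.eq_or_lt).resolve_right fun hlt => h.2 h'.lt hlt).symm
  choose g hg hgb using h1
  -- The chosen successors form an antichain: `g x < g y` would give `g x ≤ y`, putting `g x` into
  -- the downwards closed set `b`.
  have key : ∀ x y : b, g x ≤ g y → x = y := by
    intro x y hxy
    rcases hxy.eq_or_lt with h | h
    · refine Subtype.ext (eq_of_le_of_height_eq (hg x).le ((hg y).le.trans h.ge) ?_)
      have h1 := (covBy_iff_height.1 (hg x)).2
      rw [h, (covBy_iff_height.1 (hg y)).2] at h1
      exact (Order.succ_injective (by simpa only [Order.succ_eq_add_one] using h1)).symm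
    · refine absurd (hb.2 ?_ y.2) (hgb x)
      refine le_of_le_of_height_le h.le (hg y).le ?_
      have := height_strictMono h
      rwa [(covBy_iff_height.1 (hg y)).2, Order.lt_add_one_iff] at this
  have hc : (Set.range g).Countable := hccc _ (by
    rintro _ ⟨x, rfl⟩ _ ⟨y, rfl⟩ hne h
    exact hne (congrArg g (key x y h)))
  have : Countable (Set.range g) := hc.to_subtype
  have hinj : Function.Injective (Set.rangeFactorization g) := fun x y h =>
    key x y (congrArg Subtype.val h).le
  exact Set.countable_coe_iff.1 hinj.countable

end Basic

/-! ### Translation along a coherent family -/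

namespace CoherentFamily

variable {T : Type u} [PartialOrder T] [IsTree T] (C : CoherentFamily T)

/-- The map `ψ_{rs}`, extended by the identity to the whole tree. -/
noncomputable def tr (r s x : T) : T :=
  open Classical in if h : height r = height s ∧ r ≤ x then C.ψ r s h.1 ⟨x, h.2⟩ else x

variable {r s t x y : T}

theorem tr_eq (h : height r = height s) (hx : r ≤ x) : C.tr r s x = C.ψ r s h ⟨x, hx⟩ :=
  dif_pos ⟨h, hx⟩

theorem le_tr (h : height r = height s) (hx : r ≤ x) : s ≤ C.tr r s x := by
  rw [C.tr_eq h hx]; exact (C.ψ r s h ⟨x, hx⟩).2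

theorem height_tr (h : height r = height s) (hx : r ≤ x) : height (C.tr r s x) = height x := by
  rw [C.tr_eq h hx, height_ici, height_orderIso, ← h]
  exact (height_ici (⟨x, hx⟩ : Set.Ici r)).symm

theorem tr_le_tr_iff (h : height r = height s) (hx : r ≤ x) (hy : r ≤ y) :
    C.tr r s x ≤ C.tr r s y ↔ x ≤ y := by
  rw [C.tr_eq h hx, C.tr_eq h hy, Subtype.coe_le_coe, OrderIso.le_iff_le]
  exact Iff.rfl

theorem tr_self (hx : r ≤ x) : C.tr r r x = x := by
  rw [C.tr_eq rfl hx, C.ψ_self]; rfl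

theorem tr_tr (h : height r = height s) (h' : height s = height t) (hx : r ≤ x) :
    C.tr s t (C.tr r s x) = C.tr r t x := by
  rw [C.tr_eq h' (C.le_tr h hx), C.tr_eq (h.trans h') hx, C.commutativity r s t h h']
  simp only [C.tr_eq h hx, Subtype.coe_eta, OrderIso.trans_apply]

theorem tr_coherent (h : height r = height s) (ht : r ≤ t) (hx : t ≤ x) :
    C.tr t (C.tr r s t) x = C.tr r s x := by
  rw [C.tr_eq (C.height_tr h ht).symm hx, C.tr_eq h (ht.trans hx)]
  exact C.coherence r s h t _ _ ht (C.le_tr h ht) (Subtype.ext (C.tr_eq h ht).symm) x hx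

theorem tr_root (h : height r = height s) : C.tr r s r = s :=
  (eq_of_le_of_height_eq (C.le_tr h le_rfl) le_rfl ((C.height_tr h le_rfl).trans h).symm).symm

theorem res_tr (h : height r = height s) (hx : r ≤ x) {β : Ordinal.{u}} (hr : height r ≤ β)
    (hβ : β ≤ height x) : res (C.tr r s x) β = C.tr r s (res x β) := by
  have h1 : r ≤ res x β := le_res hx hr hβ
  exact res_eq ((C.tr_le_tr_iff h h1 hx).2 (res_le x β)) ((C.height_tr h h1).trans (height_res hβ))

theorem tr_covBy_tr (h : height r = height s) (hx : r ≤ x) (hxy : x ⋖ y) :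
    C.tr r s x ⋖ C.tr r s y := by
  rw [covBy_iff_height] at hxy ⊢
  have hy := hx.trans hxy.1
  exact ⟨(C.tr_le_tr_iff h hx hy).2 hxy.1, by rw [C.height_tr h hx, C.height_tr h hy, hxy.2]⟩

/-- Transitivity supplies one level `γ`; by coherence every later level below the limit works too.
Thus finitely many nodes can share a level. -/
theorem exists_tr_eq (h : height t = height x) (hl : Order.IsSuccLimit (height t)) :
    ∃ γ < height t, ∀ β, γ ≤ β → β < height t → C.tr (res t β) (res x β) t = x := by
  obtain ⟨r, s, hrs, hr, hs, he⟩ := C.transitivity t x h hl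
  refine ⟨height r, height_strictMono hr, fun β h1 h2 => ?_⟩
  rw [← C.tr_eq hrs hr.le] at he
  have h3 : res x β = C.tr r s (res t β) := by
    rw [← he, C.res_tr hrs hr.le h1 h2.le]
  rw [h3, C.tr_coherent hrs (le_res hr.le h1 h2.le) (res_le _ _), he]

end CoherentFamily

/-! ### Labels invariant under translation -/

section Labelling

variable {T : Type u} [PartialOrder T] [IsTree T]

/-- The immediate successors in an `ℵ₀`-branching coherent tree can be labelled by natural numbers
in such a way that the maps of the coherent family preserve the labels. -/
theorem exists_labelling (C : CoherentFamily T) (hb : IsBranching T ℵ₀)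
    (hmax : ∀ x : T, ∃ y, x < y) :
    ∃ l : T → ℕ, (∀ s t t' : T, s ⋖ t → s ⋖ t' → l t = l t' → t = t') ∧
      (∀ s i, ∃ t, s ⋖ t ∧ l t = i) ∧
      ∀ r s x y : T, height r = height s → r ≤ x → x ⋖ y → l (C.tr r s y) = l y := by
  classical
  have he : ∀ s : T, Nonempty ({t : T // s ⋖ t} ≃ ℕ) := fun s => by
    have h1 : ¬ IsMax s := fun h => by
      obtain ⟨y, hy⟩ := hmax s
      exact h.not_lt hy
    exact (Cardinal.denumerable_iff.2 (hb s h1)).map fun d => @Denumerable.eqv _ d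
  let e : ∀ s : T, {t : T // s ⋖ t} ≃ ℕ := fun s => (he s).some
  -- One base node per height: the successors of base nodes are enumerated arbitrarily, and all
  -- other labels are pulled back along ψ to the base node.
  let b : T → T := fun s => Set.rangeSplitting height ⟨height s, s, rfl⟩
  have hbs : ∀ s, height s = height (b s) := fun s =>
    (Set.apply_rangeSplitting (height (T := T)) ⟨height s, s, rfl⟩).symm
  have hb' : ∀ s t, height s = height t → b s = b t := fun s t h =>
    congrArg (Set.rangeSplitting height) (Subtype.ext h)
  have hcov : ∀ s t, s ⋖ t → b s ⋖ C.tr s (b s) t := fun s t h => by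
    have h1 := C.tr_covBy_tr (hbs s) le_rfl h
    rwa [C.tr_root (hbs s)] at h1
  have hcongr : ∀ a a' t t' (h : a ⋖ t) (h' : a' ⋖ t'), a = a' → t = t' →
      e a ⟨t, h⟩ = e a' ⟨t', h'⟩ := by
    rintro a _ t _ _ _ rfl rfl; rfl
  let l : T → ℕ := fun t => if h : ∃ s, s ⋖ t then e (b h.choose) ⟨_, hcov _ _ h.choose_spec⟩ else 0
  have hl : ∀ s t (h : s ⋖ t), l t = e (b s) ⟨_, hcov s t h⟩ := fun s t h => by
    have h1 : ∃ s, s ⋖ t := ⟨s, h⟩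
    have h2 : h1.choose = s := by
      refine eq_of_le_of_height_eq h1.choose_spec.le h.le (Order.succ_injective ?_)
      simp only [Order.succ_eq_add_one]
      rw [← (covBy_iff_height.1 h).2, ← (covBy_iff_height.1 h1.choose_spec).2]
    simp only [l, dif_pos h1]
    exact hcongr _ _ _ _ _ _ (by rw [h2]) (by rw [h2])
  refine ⟨l, fun s t t' h h' htt => ?_, fun s i => ?_, fun r s x y hrs hx hxy => ?_⟩
  · rw [hl s t h, hl s t' h'] at htt
    have h1 : C.tr s (b s) t = C.tr s (b s) t' := congrArg Subtype.val ((e (b s)).injective htt)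
    exact le_antisymm ((C.tr_le_tr_iff (hbs s) h.le h'.le).1 h1.le)
      ((C.tr_le_tr_iff (hbs s) h'.le h.le).1 h1.ge)
  · obtain ⟨⟨u, hu⟩, rfl⟩ := (e (b s)).surjective i
    have h1 := C.tr_covBy_tr (hbs s).symm le_rfl hu
    rw [C.tr_root (hbs s).symm] at h1
    refine ⟨_, h1, ?_⟩
    rw [hl s _ h1]
    refine hcongr _ _ _ _ _ _ rfl ?_
    rw [C.tr_tr (hbs s).symm (hbs s) hu.le, C.tr_self hu.le]
  · have h1 := C.tr_covBy_tr hrs hx hxy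
    have h2 := C.height_tr hrs hx
    rw [hl x y hxy, hl _ _ h1]
    have h3 := hb' _ _ h2
    refine hcongr _ _ _ _ _ _ h3 ?_
    rw [h3, ← C.tr_coherent hrs hx hxy.le, C.tr_tr h2.symm (h2.trans (hbs x)) hxy.le]

end Labelling

/-! ### Quotients of trees by level preserving congruences -/

section Quotient

/-- A level preserving equivalence relation on a tree that is compatible with restriction. -/
structure TreeCongruence (T : Type u) [PartialOrder T] [IsTree T] where
  /-- the underlying relation -/
  rel : T → T → Prop
  equiv : Equivalence rel
  height_eq : ∀ {x y : T}, rel x y → height x = height y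
  rel_res : ∀ {x y : T}, rel x y → ∀ β ≤ height x, rel (res x β) (res y β)

/-- An order-reflecting map is injective and sends antichains to antichains; monotonicity is not
needed. -/
theorem IsCCC.of_reflects {P Q : Type*} [PartialOrder P] [PartialOrder Q] (hQ : IsCCC Q)
    (g : P → Q) (hg : ∀ x y, g x ≤ g y → x ≤ y) : IsCCC P := by
  intro A hA
  have hinj : Function.Injective g := fun x y h => le_antisymm (hg x y h.le) (hg y x h.ge)
  refine Set.countable_of_injective_of_countable_image hinj.injOn (hQ (g '' A) ?_)
  rintro _ ⟨x, hx, rfl⟩ _ ⟨y, hy, rfl⟩ hne h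
  exact hA hx hy (fun e => hne (congrArg g e)) (hg x y h)

namespace TreeCongruence

variable {T : Type u} [PartialOrder T] [IsTree T] (c : TreeCongruence T)

/-- This lifting of relations to predecessors makes the quotient order independent of
representatives and transitive. -/
theorem exists_le_of_rel {x y y' : T} (h : x ≤ y) (hy : c.rel y y') :
    ∃ x' ≤ y', c.rel x x' :=
  ⟨res y' (height x), res_le _ _, by
    simpa only [res_eq h rfl] using c.rel_res hy (height x) (height_mono h)⟩

/-- The setoid of a congruence. -/
def setoid : Setoid T := ⟨c.rel, c.equiv⟩

/-- The quotient of a tree by a congruence. -/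
def Quo : Type u := Quotient c.setoid

/-- The class of a node. -/
def cls (x : T) : c.Quo := Quotient.mk c.setoid x

/-- A representative of a class. -/
noncomputable def out (q : c.Quo) : T := Quotient.out q

@[simp] theorem cls_out (q : c.Quo) : c.cls (c.out q) = q := Quotient.out_eq q

theorem cls_eq_iff {x y : T} : c.cls x = c.cls y ↔ c.rel x y := Quotient.eq (r := c.setoid)

instance : PartialOrder c.Quo where
  le p q := Quotient.liftOn₂ p q (fun x y => ∃ x' ≤ y, c.rel x x') (by
    intro x y x₂ y₂ hx hy
    refine propext ⟨?_, ?_⟩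
    · rintro ⟨x', h, h'⟩
      obtain ⟨z, hz, hz'⟩ := c.exists_le_of_rel h hy
      exact ⟨z, hz, c.equiv.trans (c.equiv.symm hx) (c.equiv.trans h' hz')⟩
    · rintro ⟨x', h, h'⟩
      obtain ⟨z, hz, hz'⟩ := c.exists_le_of_rel h (c.equiv.symm hy)
      exact ⟨z, hz, c.equiv.trans hx (c.equiv.trans h' hz')⟩)
  le_refl p := by
    induction p using Quotient.inductionOn with
    | h x => exact ⟨x, le_rfl, c.equiv.refl x⟩
  le_trans p q r := by
    induction p, q using Quotient.inductionOn₂ with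
    | h x y =>
      induction r using Quotient.inductionOn with
      | h z =>
        rintro ⟨x', hx, hx'⟩ ⟨y', hy, hy'⟩
        obtain ⟨w, hw, hw'⟩ := c.exists_le_of_rel hx hy'
        exact ⟨w, hw.trans hy, c.equiv.trans hx' hw'⟩
  le_antisymm p q := by
    induction p, q using Quotient.inductionOn₂ with
    | h x y =>
      rintro ⟨x', hx, hx'⟩ ⟨y', hy, hy'⟩
      have h1 : height x' = height y := le_antisymm (height_mono hx)
        ((c.height_eq hy').le.trans ((height_mono hy).trans (c.height_eq hx').le))
      rw [eq_of_le_of_height_eq hx le_rfl h1] at hx'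
      exact Quotient.sound (s := c.setoid) hx'

theorem cls_le_cls {x y : T} : c.cls x ≤ c.cls y ↔ ∃ x' ≤ y, c.rel x x' := Iff.rfl

theorem cls_mono {x y : T} (h : x ≤ y) : c.cls x ≤ c.cls y :=
  c.cls_le_cls.2 ⟨x, h, c.equiv.refl x⟩

theorem cls_lt_cls {x y : T} : c.cls x < c.cls y ↔ ∃ x' < y, c.rel x x' := by
  constructor
  · intro h
    obtain ⟨x', h1, h2⟩ := c.cls_le_cls.1 h.le
    refine ⟨x', h1.lt_of_ne ?_, h2⟩
    rintro rfl
    exact h.ne (c.cls_eq_iff.2 h2)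
  · rintro ⟨x', h1, h2⟩
    refine (c.cls_le_cls.2 ⟨x', h1.le, h2⟩).lt_of_ne fun h => ?_
    have h3 := (c.height_eq h2).symm.trans (c.height_eq (c.cls_eq_iff.1 h))
    exact (height_strictMono h1).ne h3

theorem cls_strictMono {x y : T} (h : x < y) : c.cls x < c.cls y :=
  c.cls_lt_cls.2 ⟨x, h, c.equiv.refl x⟩

/-- The predecessors of a class correspond to those of a representative. -/
noncomputable def relIsoIio (x : T) : ((· < ·) : Set.Iio x → Set.Iio x → Prop) ≃r
    ((· < ·) : Set.Iio (c.cls x) → Set.Iio (c.cls x) → Prop) :=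
  RelIso.ofSurjective
    (RelEmbedding.ofMonotone (fun y => ⟨c.cls y, c.cls_strictMono y.2⟩)
      fun _ _ h => c.cls_strictMono h) (by
    rintro ⟨q, hq⟩
    obtain ⟨y, rfl⟩ : ∃ y, c.cls y = q := ⟨c.out q, c.cls_out q⟩
    obtain ⟨y', h1, h2⟩ := c.cls_lt_cls.1 hq
    exact ⟨⟨y', h1⟩, Subtype.ext (c.cls_eq_iff.2 (c.equiv.symm h2))⟩)

instance : IsTree c.Quo where
  wo q := by
    rw [← c.cls_out q]
    exact (c.relIsoIio (c.out q)).symm.toRelEmbedding.isWellOrder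

@[simp] theorem height_cls (x : T) : height (c.cls x) = height x :=
  (c.relIsoIio x).ordinalType_congr.symm

@[simp] theorem height_out (q : c.Quo) : height (c.out q) = height q := by
  rw [← c.height_cls, c.cls_out]

theorem level_quo (α : Ordinal.{u}) : level c.Quo α = c.cls '' level T α := by
  ext q
  constructor
  · exact fun h => ⟨c.out q, (c.height_out q).trans h, c.cls_out q⟩
  · rintro ⟨x, hx, rfl⟩
    exact (c.height_cls x).trans hx

theorem treeHeight_quo : treeHeight c.Quo = treeHeight T := by
  simp only [treeHeight, level_quo, Set.image_eq_empty]

theorem cls_covBy_cls {x y : T} (h : x ⋖ y) : c.cls x ⋖ c.cls y := by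
  rw [covBy_iff_height] at h ⊢
  exact ⟨c.cls_mono h.1, by simpa using h.2⟩

theorem isCCC_quo (h : IsCCC T) : IsCCC c.Quo :=
  h.of_reflects c.out fun p q h => by simpa using c.cls_mono h

/-- The root and the extension property descend from `T`; only splitting and uniqueness at limits
could be lost by identification, so these are the hypotheses. -/
theorem isNormal_quo (hT : IsNormal T)
    (hsplit : ∀ s : T, height s + 1 < treeHeight T → ∃ t u, s ⋖ t ∧ s ⋖ u ∧ ¬ c.rel t u)
    (hlim : ∀ x y : T, height x = height y → Order.IsSuccLimit (height x) →
      (∀ β < height x, c.rel (res x β) (res y β)) → c.rel x y) : IsNormal c.Quo where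
  root := by
    obtain ⟨r, hr, hu⟩ := hT.root
    have hmin : ∀ x : T, IsMin (c.cls x) → IsMin x := fun x h => by
      rw [isMin_iff_forall_not_lt] at h ⊢
      exact fun y hy => h _ (c.cls_strictMono hy)
    refine ⟨c.cls r, ?_, fun q hq => ?_⟩
    · rw [isMin_iff_forall_not_lt] at hr ⊢
      intro q hq
      rw [← c.cls_out q] at hq
      obtain ⟨y, hy, _⟩ := c.cls_lt_cls.1 hq
      exact hr y hy
    · rw [← c.cls_out q] at hq ⊢
      rw [hu _ (hmin _ hq)]
  splits q hq := by
    rw [treeHeight_quo, ← c.height_out] at hq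
    obtain ⟨t, u, ht, hu, htu⟩ := hsplit _ hq
    refine ⟨c.cls t, c.cls u, ?_, ?_, fun h => htu (c.cls_eq_iff.1 h)⟩
    · simpa using c.cls_covBy_cls ht
    · simpa using c.cls_covBy_cls hu
  extends_up q α hα hne := by
    rw [level_quo] at hne ⊢
    rw [← c.height_out] at hα
    obtain ⟨t, ht, hlt⟩ := hT.extends_up _ α hα hne.of_image
    exact ⟨c.cls t, ⟨t, ht, rfl⟩, by simpa using c.cls_strictMono hlt⟩
  unique_limits p q hp hq h := by
    obtain ⟨x, rfl⟩ : ∃ x, c.cls x = p := ⟨c.out p, c.cls_out p⟩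
    obtain ⟨y, rfl⟩ : ∃ y, c.cls y = q := ⟨c.out q, c.cls_out q⟩
    rw [height_cls] at hp hq
    have hsub : ∀ z w : T, Set.Iio (c.cls z) = Set.Iio (c.cls w) → ∀ β < height z,
        β < height w ∧ c.rel (res z β) (res w β) := by
      intro z w hzw β hβ
      have h1 : c.cls (res z β) ∈ Set.Iio (c.cls w) := hzw ▸ c.cls_strictMono (res_lt hβ)
      obtain ⟨v, hv, hv'⟩ := c.cls_lt_cls.1 h1
      have h2 : height v = β := (c.height_eq hv').symm.trans (height_res hβ.le)
      exact ⟨h2 ▸ height_strictMono hv, by rwa [res_eq hv.le h2]⟩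
    refine c.cls_eq_iff.2 (hlim x y (le_antisymm ?_ ?_) hp fun β hβ => (hsub x y h β hβ).2)
    · exact le_of_forall_lt fun β hβ => (hsub x y h β hβ).1
    · exact le_of_forall_lt fun β hβ => (hsub y x h.symm β hβ).1

end TreeCongruence

end Quotient

/-! ### Congruences driven by codes and partitions -/

section Coded

/-- A congruence on a labelled coherent tree that identifies the successors of a class according to
the partition `p j`, where `j` is the code of the class in its level. -/
structure CodedCongruence {T : Type u} [PartialOrder T] [IsTree T] (C : CoherentFamily T)
    (l : T → ℕ) (p : ℕ → ℕ → ℕ) extends TreeCongruence T where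
  /-- the code of the class of a node in its level -/
  code : T → ℕ
  code_eq_iff : ∀ {x y : T}, height x = height y → (code x = code y ↔ rel x y)
  rel_iff_of_covBy : ∀ {s t s' t' : T}, s ⋖ t → s' ⋖ t' →
    (rel t t' ↔ rel s s' ∧ p (code s) (l t) = p (code s') (l t'))
  rel_of_limit : ∀ {x y : T}, height x = height y → Order.IsSuccLimit (height x) →
    (∀ β < height x, rel (res x β) (res y β)) → rel x y
  rel_tr : ∀ {r s x : T}, rel r s → r ≤ x → rel x (C.tr r s x)

variable {T : Type u} [PartialOrder T] [IsTree T]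

/-- Codes for the classes in the levels of a tree, where the values `p (J (x|β)) (l (x|(β+1)))`
for `β < ht x` determine the class of `x`. -/
theorem exists_code (hccc : IsCCC T) (l : T → ℕ) (p : ℕ → ℕ → ℕ) :
    ∃ J : T → ℕ, ∀ x y : T, height x = height y →
      (J x = J y ↔ ∀ β < height x,
        p (J (res x β)) (l (res x (β + 1))) = p (J (res y β)) (l (res y (β + 1)))) := by
  have he : ∃ e : T → ℕ, ∀ x y, height x = height y → e x = e y → x = y := by
    have h : ∀ α : Ordinal.{u}, ∃ e : T → ℕ, Set.InjOn e (level T α) := fun α =>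
      (Set.countable_iff_exists_injOn.1 (hccc _ (isAntichain_level α)))
    choose e he using h
    exact ⟨fun x => e (height x) x, fun x y hxy h => he (height y) hxy rfl (by simpa [hxy] using h)⟩
  obtain ⟨e, he⟩ := he
  let agree : (α : Ordinal.{u}) → (∀ β < α, T → ℕ) → T → T → Prop := fun α K x y =>
    ∀ β (h : β < α), p (K β h (res x β)) (l (res x (β + 1))) =
      p (K β h (res y β)) (l (res y (β + 1)))
  -- The code of a node is the least `e`-value in its class. The class depends only on codes at
  -- lower levels, which permits the recursion.
  let step : (α : Ordinal.{u}) → (∀ β < α, T → ℕ) → T → ℕ := fun α K x =>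
    sInf {k | ∃ y, e y = k ∧ height y = α ∧ agree α K y x}
  let K : Ordinal.{u} → T → ℕ := WellFounded.fix Ordinal.lt_wf step
  have hK : ∀ α, K α = step α fun β _ => K β := fun α => WellFounded.fix_eq _ _ _
  have hagree : ∀ x y, height x = height y → (agree (height x) (fun β _ => K β) x y ↔
      ∀ β < height x, p (K (height (res x β)) (res x β)) (l (res x (β + 1))) =
        p (K (height (res y β)) (res y β)) (l (res y (β + 1)))) := fun x y h =>
    forall₂_congr fun β hβ => by rw [height_res hβ.le, height_res (h ▸ hβ.le)]
  refine ⟨fun x => K (height x) x, fun x y hxy => ?_⟩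
  rw [← hagree x y hxy]
  beta_reduce
  rw [← hxy, hK]
  constructor
  · intro h
    have hmem : ∀ z, height z = height x → ∃ w, e w = step (height x) (fun β _ => K β) z ∧
        height w = height x ∧ agree (height x) (fun β _ => K β) w z := fun z hz =>
      Nat.sInf_mem (s := {k | ∃ y, e y = k ∧ height y = height x ∧
        agree (height x) (fun β _ => K β) y z}) ⟨e z, z, rfl, hz, fun _ _ => rfl⟩
    -- The minima are attained in both classes; equal codes force the same minimiser, through which
    -- `x` and `y` agree.
    obtain ⟨w, hw, hw', hwx⟩ := hmem x rfl
    obtain ⟨v, hv, hv', hvy⟩ := hmem y hxy.symm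
    rw [← h, ← hw] at hv
    rw [he v w (hv'.trans hw'.symm) hv] at hvy
    exact fun β hβ => (hwx β hβ).symm.trans (hvy β hβ)
  · intro h
    refine congrArg sInf (Set.ext fun k => exists_congr fun w => and_congr Iff.rfl
      (and_congr Iff.rfl (forall₂_congr fun β hβ => ?_)))
    rw [h β hβ]

/-- Nodes of equal height are related when the sequences of pieces read off along their predecessors
coincide. Translation between related nodes preserves these sequences, because it preserves labels
and, inductively, codes. -/
theorem nonempty_codedCongruence (hccc : IsCCC T) (C : CoherentFamily T)
    (l : T → ℕ)
    (hl : ∀ r s x y : T, height r = height s → r ≤ x → x ⋖ y → l (C.tr r s y) = l y)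
    (p : ℕ → ℕ → ℕ) : Nonempty (CodedCongruence C l p) := by
  obtain ⟨J, hJ⟩ := exists_code hccc l p
  let v : T → Ordinal.{u} → ℕ := fun x β => p (J (res x β)) (l (res x (β + 1)))
  have hv : ∀ (x y : T) (β : Ordinal.{u}), y ≤ x → β < height y → v x β = v y β := by
    intro x y β h hβ
    simp only [v]
    rw [res_of_le h hβ.le, res_of_le h (Order.add_one_le_of_lt hβ)]
  have hvs : ∀ s t : T, s ⋖ t → v t (height s) = p (J s) (l t) := by
    intro s t h
    simp only [v]
    rw [res_eq h.le rfl, res_self (covBy_iff_height.1 h).2]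
  let R : T → T → Prop := fun x y => height x = height y ∧ ∀ β < height x, v x β = v y β
  have hJR : ∀ x y, height x = height y → (J x = J y ↔ R x y) := fun x y h =>
    (hJ x y h).trans ⟨fun h' => ⟨h, h'⟩, fun h' => h'.2⟩
  have hRres : ∀ x y, R x y → ∀ β ≤ height x, R (res x β) (res y β) := by
    rintro x y ⟨h, h'⟩ β hβ
    have h1 := height_res hβ
    have h2 := height_res (h ▸ hβ : β ≤ height y)
    refine ⟨h1.trans h2.symm, fun γ hγ => ?_⟩
    rw [← hv x _ γ (res_le _ _) hγ, ← hv y _ γ (res_le _ _) (by rwa [h2, ← h1])]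
    exact h' γ (hγ.trans_le (height_mono (res_le _ _)))
  refine ⟨{
    rel := R
    equiv := ⟨fun x => ⟨rfl, fun _ _ => rfl⟩,
      fun h => ⟨h.1.symm, fun β hβ => (h.2 β (h.1 ▸ hβ)).symm⟩,
      fun h h' => ⟨h.1.trans h'.1, fun β hβ => (h.2 β hβ).trans (h'.2 β (h.1 ▸ hβ))⟩⟩
    height_eq := fun h => h.1
    rel_res := fun {x y} h => hRres x y h
    code := J
    code_eq_iff := fun {x y} h => hJR x y h
    rel_iff_of_covBy := ?_
    rel_of_limit := ?_
    rel_tr := ?_ }⟩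
  · intro s t s' t' h h'
    have e1 := (covBy_iff_height.1 h).2
    have e2 := (covBy_iff_height.1 h').2
    have hs : height s < height t := height_strictMono h.lt
    constructor
    · intro hR
      have e3 : height s = height s' := by
        have := hR.1
        rw [e1, e2] at this
        exact Order.succ_injective (by simpa only [Order.succ_eq_add_one] using this)
      have h1 := hRres t t' hR (height s) hs.le
      rw [res_eq h.le rfl, res_eq h'.le e3.symm] at h1
      refine ⟨h1, ?_⟩
      rw [← hvs s t h, ← hvs s' t' h', ← e3]
      exact hR.2 _ hs
    · rintro ⟨hR, hp⟩
      refine ⟨by rw [e1, e2, hR.1], fun β hβ => ?_⟩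
      rw [e1, Order.lt_add_one_iff] at hβ
      rcases hβ.eq_or_lt with rfl | hβ
      · rw [hvs s t h, hp, ← hvs s' t' h', hR.1]
      · rw [hv t s β h.le hβ, hv t' s' β h'.le (hR.1 ▸ hβ)]
        exact hR.2 β hβ
  · intro x y hxy hlim h
    refine ⟨hxy, fun β hβ => ?_⟩
    have h1 := hlim.add_one_lt hβ
    have h2 := height_res h1.le
    have h3 : height (res y (β + 1)) = β + 1 := height_res (hxy ▸ h1.le)
    have h4 : β < β + 1 := Order.lt_add_one_iff.2 le_rfl
    rw [hv x (res x (β + 1)) β (res_le _ _) (h4.trans_eq h2.symm),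
      hv y (res y (β + 1)) β (res_le _ _) (h4.trans_eq h3.symm)]
    exact (h _ h1).2 β (h4.trans_eq h2.symm)
  · intro r s x hR hx
    have hrs := hR.1
    induction hα : height x using WellFoundedLT.induction generalizing x with
    | _ α ih =>
      subst hα
      have hxy := C.height_tr hrs hx
      refine ⟨hxy.symm, fun β hβ => ?_⟩
      rcases lt_or_ge β (height r) with hr | hr
      · rw [hv x r β hx hr, hv _ s β (C.le_tr hrs hx) (hrs ▸ hr)]
        exact hR.2 β hr
      · have hr' : r ≤ res x β := le_res hx hr hβ.le
        have h1 : R (res x β) (C.tr r s (res x β)) :=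
          ih _ (height_strictMono (res_lt hβ)) hr' rfl
        have h2 := Order.add_one_le_of_lt hβ
        simp only [v]
        rw [C.res_tr hrs hx hr hβ.le,
          C.res_tr hrs hx (hr.trans (Order.lt_add_one_iff.2 le_rfl).le) h2,
          (hJR _ _ h1.1).2 h1, hl r s _ _ hrs hr' (res_covBy_res hβ)]

end Coded

/-! ### Simultaneous lifting of classes -/

section Lifting

variable {T : Type u} [PartialOrder T] [IsTree T]

/-- Finitely many classes, in possibly different coded quotients, are represented simultaneously by
the translates of a single node, provided that this can be achieved at successor steps. -/
theorem exists_common_lift {κ : Type*} [Finite κ] [Nonempty κ] (C : CoherentFamily T) (l : T → ℕ)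
    (hls : ∀ s i, ∃ t, s ⋖ t ∧ l t = i)
    (hl : ∀ r s x y : T, height r = height s → r ≤ x → x ⋖ y → l (C.tr r s y) = l y)
    (p : κ → ℕ → ℕ → ℕ) (c : ∀ i, CodedCongruence C l (p i)) (t : T) (r : κ → T)
    (hr : ∀ i, height t = height (r i))
    (hp : ∀ y, t ≤ y → ∀ w : κ → ℕ, ∃ a, ∀ i, p i ((c i).code (C.tr t (r i) y)) a = w i)
    (α : Ordinal.{u}) (hα : height t ≤ α) (z : κ → T) (hz : ∀ i, height (z i) = α)
    (hzr : ∀ i, (c i).rel (r i) (res (z i) (height t))) :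
    ∃ x, t ≤ x ∧ height x = α ∧ ∀ i, (c i).rel (C.tr t (r i) x) (z i) := by
  cases nonempty_fintype κ
  induction α using WellFoundedLT.induction generalizing z with
  | _ α ih =>
  have ih' : ∀ β < α, height t ≤ β → ∃ y, t ≤ y ∧ height y = β ∧
      ∀ i, (c i).rel (C.tr t (r i) y) (res (z i) β) := by
    intro β hβ hβ'
    have h1 : ∀ i, height (res (z i) β) = β := fun i => height_res (hβ.le.trans (hz i).ge)
    refine ih β hβ hβ' (fun i => res (z i) β) h1 fun i => ?_
    rw [← res_of_le (res_le (z i) β) (hβ'.trans (h1 i).ge)]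
    exact hzr i
  rcases hα.eq_or_lt with rfl | hα
  · refine ⟨t, le_rfl, rfl, fun i => ?_⟩
    rw [C.tr_root (hr i)]
    simpa only [res_self (hz i)] using hzr i
  rcases Ordinal.zero_or_succ_or_isSuccLimit α with rfl | ⟨β, rfl⟩ | hlim
  · exact absurd hα not_lt_bot
  · rw [Order.succ_eq_add_one] at *
    have hβ : β < β + 1 := Order.lt_add_one_iff.2 le_rfl
    obtain ⟨y, hty, hy, hyz⟩ := ih' β hβ (Order.lt_add_one_iff.1 hα)
    obtain ⟨a, ha⟩ := hp y hty fun i => p i ((c i).code (res (z i) β)) (l (z i))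
    obtain ⟨x, hyx, hx⟩ := hls y a
    refine ⟨x, hty.trans hyx.le, by rw [(covBy_iff_height.1 hyx).2, hy], fun i => ?_⟩
    have h1 : res (z i) β ⋖ z i := by
      have h := res_covBy_res (hβ.trans_eq (hz i).symm)
      rwa [res_self (hz i)] at h
    rw [(c i).rel_iff_of_covBy (C.tr_covBy_tr (hr i) hty hyx) h1, hl t (r i) y x (hr i) hty hyx, hx]
    exact ⟨hyz i, ha i⟩
  · obtain ⟨i₀⟩ := ‹Nonempty κ›
    have htr : ∀ i, ∃ γ < α, ∀ β, γ ≤ β → β < α →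
        C.tr (res (z i₀) β) (res (z i) β) (z i₀) = z i := fun i => by
      simpa only [hz] using C.exists_tr_eq ((hz i₀).trans (hz i).symm) (by rwa [hz])
    choose g hg hgz using htr
    -- As `κ` is finite, one level below the limit `α` serves all `i`.
    let γ := max (height t) (Finset.univ.sup g)
    have hγ : γ < α := max_lt hα ((Finset.sup_lt_iff hlim.bot_lt).2 fun i _ => hg i)
    have hγt : height t ≤ γ := le_max_left _ _
    have hγg : ∀ i, C.tr (res (z i₀) γ) (res (z i) γ) (z i₀) = z i := fun i =>
      hgz i γ ((Finset.le_sup (Finset.mem_univ i)).trans (le_max_right _ _)) hγ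
    obtain ⟨y, hty, hy, hyz⟩ := ih' γ hγ hγt
    have hzγ : ∀ i, height (res (z i) γ) = γ := fun i => height_res (hγ.le.trans (hz i).ge)
    have h0 : height (res (z i₀) γ) = height y := (hzγ i₀).trans hy.symm
    have hyx : y ≤ C.tr (res (z i₀) γ) y (z i₀) := C.le_tr h0 (res_le _ _)
    -- The part of `z i₀` above level `γ` is moved on top of the lift `y` obtained at level `γ`.
    refine ⟨C.tr (res (z i₀) γ) y (z i₀), hty.trans hyx,
      (C.height_tr h0 (res_le _ _)).trans (hz i₀), fun i => ?_⟩
    have h1 : height y = height (C.tr t (r i) y) := (C.height_tr (hr i) hty).symm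
    have h2 : height (res (z i₀) γ) = height (res (z i) γ) := (hzγ i₀).trans (hzγ i).symm
    -- Two routes for translating `z i₀`, via `y` and via the restriction of `z i`, agree by
    -- commutativity and coherence. So the result is `z i` translated between related nodes, hence
    -- related to `z i`.
    have h3 : C.tr t (r i) (C.tr (res (z i₀) γ) y (z i₀)) =
        C.tr (res (z i) γ) (C.tr t (r i) y) (z i) := by
      rw [← C.tr_coherent (hr i) hty hyx, C.tr_tr h0 h1 (res_le _ _),
        ← C.tr_tr h2 (h2.symm.trans (h0.trans h1)) (res_le _ _), hγg i]
    rw [h3]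
    exact (c i).equiv.symm ((c i).rel_tr ((c i).equiv.symm (hyz i)) (res_le _ _))

/-- The classes of a node in the quotients given by the rows of an optimal matrix determine it. -/
theorem eq_of_forall_rel {ι : Type*} [Nonempty ι] (hN : IsNormal T) (C : CoherentFamily T)
    (l : T → ℕ) (hli : ∀ s t t' : T, s ⋖ t → s ⋖ t' → l t = l t' → t = t')
    (p : ι → ℕ → ℕ → ℕ) (hp : ∀ j : ι → ℕ, Function.Injective fun i m => p m (j m) i)
    (c : ∀ m, CodedCongruence C l (p m)) (x y : T) (h : ∀ m, (c m).rel x y) : x = y := by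
  obtain ⟨m₀⟩ := ‹Nonempty ι›
  have hxy := (c m₀).height_eq (h m₀)
  induction hα : height x using WellFoundedLT.induction generalizing x y with
  | _ α ih =>
  subst hα
  have ih' : ∀ β < height x, res x β = res y β := fun β hβ => by
    have h1 := height_res hβ.le
    have h2 := height_res (hβ.le.trans hxy.le)
    exact ih β hβ _ _ (fun m => (c m).rel_res (h m) β hβ.le) (h1.trans h2.symm) h1
  rcases Ordinal.zero_or_succ_or_isSuccLimit (height x) with h0 | ⟨β, hβ⟩ | hlim
  · exact eq_of_height_eq_zero hN h0 (hxy ▸ h0)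
  · rw [Order.succ_eq_add_one] at hβ
    have hlt : β < height x := hβ ▸ Order.lt_add_one_iff.2 le_rfl
    have hx := res_covBy_res hlt
    have hy := res_covBy_res (hlt.trans_eq hxy)
    rw [res_self hβ.symm] at hx
    rw [res_self (hβ.trans hxy).symm, ← ih' β hlt] at hy
    -- The two nodes have a common immediate predecessor, hence one code per row; labels in the same
    -- piece in every row are equal.
    refine hli _ _ _ hx hy (hp (fun m => (c m).code (res x β)) (funext fun m => ?_))
    exact (((c m).rel_iff_of_covBy hx hy).1 (h m)).2
  · refine hN.unique_limits x y hlim (hxy ▸ hlim) ?_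
    have hsub : ∀ v w : T, height v = height w → (∀ β < height v, res v β = res w β) →
        Set.Iio v ⊆ Set.Iio w := by
      intro v w hvw hres u hu
      have hu' := height_strictMono hu
      have h1 := res_lt (hu'.trans_eq hvw)
      rwa [← hres _ hu', res_eq (le_of_lt hu) rfl] at h1
    exact (hsub x y hxy ih').antisymm
      (hsub y x hxy.symm fun β hβ => (ih' β (hβ.trans_eq hxy.symm)).symm)

end Lifting

/-! ### Branching, normality and freeness of the quotients -/

section Free

variable {T : Type u} [PartialOrder T] [IsTree T]

namespace CodedCongruence

variable {C : CoherentFamily T} {l : T → ℕ} {p : ℕ → ℕ → ℕ} (c : CodedCongruence C l p)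

theorem exists_covBy_piece (hls : ∀ s i, ∃ t, s ⋖ t ∧ l t = i)
    (hp : ∀ j, Function.Surjective (p j)) (s : T) (i : ℕ) :
    ∃ t, s ⋖ t ∧ p (c.code s) (l t) = i := by
  obtain ⟨a, rfl⟩ := hp (c.code s) i
  obtain ⟨t, ht, rfl⟩ := hls s a
  exact ⟨t, ht, rfl⟩

theorem isBranching_quo (hls : ∀ s i, ∃ t, s ⋖ t ∧ l t = i)
    (hp : ∀ j, Function.Surjective (p j)) : IsBranching c.Quo ℵ₀ := by
  intro q _
  obtain ⟨s, rfl⟩ : ∃ s, c.cls s = q := ⟨c.out q, c.cls_out q⟩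
  choose t ht htp using c.exists_covBy_piece hls hp s
  let f : ℕ → {q // c.cls s ⋖ q} := fun i => ⟨c.cls (t i), c.cls_covBy_cls (ht i)⟩
  have hf : Function.Bijective f := by
    constructor
    · intro i j h
      have h1 : c.rel (t i) (t j) := c.cls_eq_iff.1 (congrArg Subtype.val h)
      rw [← htp i, ← htp j]
      exact ((c.rel_iff_of_covBy (ht i) (ht j)).1 h1).2
    · rintro ⟨q, hq⟩
      obtain ⟨t', rfl⟩ : ∃ t, c.cls t = q := ⟨c.out q, c.cls_out q⟩
      obtain ⟨s', hs', hss⟩ := c.cls_lt_cls.1 hq.lt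
      have h1 : s' ⋖ t' := by
        rw [covBy_iff_height] at hq ⊢
        simp only [TreeCongruence.height_cls] at hq
        exact ⟨hs'.le, by rw [hq.2, c.height_eq hss]⟩
      refine ⟨p (c.code s') (l t'), Subtype.ext (c.cls_eq_iff.2 ?_)⟩
      exact (c.rel_iff_of_covBy (ht _) h1).2 ⟨hss, htp _⟩
  exact Cardinal.denumerable_iff.1 ⟨Denumerable.mk' (Equiv.ofBijective f hf).symm⟩

theorem isNormal_quo (hN : IsNormal T) (hls : ∀ s i, ∃ t, s ⋖ t ∧ l t = i)
    (hp : ∀ j, Function.Surjective (p j)) : IsNormal c.Quo := by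
  refine c.toTreeCongruence.isNormal_quo hN (fun s _ => ?_) fun x y => c.rel_of_limit
  obtain ⟨t, ht, h0⟩ := c.exists_covBy_piece hls hp s 0
  obtain ⟨u, hu, h1⟩ := c.exists_covBy_piece hls hp s 1
  refine ⟨t, u, ht, hu, fun h => ?_⟩
  have := ((c.rel_iff_of_covBy ht hu).1 h).2
  rw [h0, h1] at this
  exact zero_ne_one this

/-- The quotient of a Souslin tree by a coded congruence is free if the partitions are
independent. -/
theorem isFree_quo (hN : IsNormal T) (hS : IsSouslin T) (hls : ∀ s i, ∃ t, s ⋖ t ∧ l t = i)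
    (hl : ∀ r s x y : T, height r = height s → r ≤ x → x ⋖ y → l (C.tr r s y) = l y)
    (hp : ∀ (s : Finset ℕ) (w : ℕ → ℕ), ∃ i, ∀ j ∈ s, p j i = w j) : IsFree c.Quo where
  normal := c.isNormal_quo hN hls fun j i => by
    obtain ⟨a, ha⟩ := hp {j} fun _ => i
    exact ⟨a, ha j (Finset.mem_singleton_self j)⟩
  height_eq := c.treeHeight_quo.trans hS.height_eq
  ccc_prod k s hs hsh := by
    classical
    let r : Fin (k + 1) → T := fun i => c.out (s i)
    have hcr : ∀ i, c.cls (r i) = s i := fun i => c.cls_out (s i)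
    have hr : ∀ i j, height (r i) = height (r j) := fun i j => by
      simpa only [r, TreeCongruence.height_out] using hsh i j
    -- The translates of `y` lie above pairwise inequivalent nodes of one level, so they are
    -- inequivalent and have distinct codes.
    have hcode : ∀ y, r 0 ≤ y → Function.Injective fun i => c.code (C.tr (r 0) (r i) y) := by
      intro y hy i j hij
      have hh : ∀ i, height (C.tr (r 0) (r i) y) = height y := fun i => C.height_tr (hr 0 i) hy
      have h1 := c.rel_res ((c.code_eq_iff ((hh i).trans (hh j).symm)).1 hij) (height (r i))
        (height_mono (C.le_tr (hr 0 i) hy))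
      rw [res_eq (C.le_tr (hr 0 i) hy) rfl, res_eq (C.le_tr (hr 0 j) hy) (hr j i),
        ← c.cls_eq_iff, hcr, hcr] at h1
      exact hs h1
    have hstep : ∀ y, r 0 ≤ y → ∀ w : Fin (k + 1) → ℕ,
        ∃ a, ∀ i, p (c.code (C.tr (r 0) (r i) y)) a = w i := by
      intro y hy w
      obtain ⟨a, ha⟩ := hp (Finset.univ.image fun i => c.code (C.tr (r 0) (r i) y))
        -- The targets are re-indexed by codes, which is unambiguous by `hcode`; the default 0 is
        -- taken only off these codes.
        (Function.extend (fun i => c.code (C.tr (r 0) (r i) y)) w 0)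
      refine ⟨a, fun i => ?_⟩
      rw [ha _ (Finset.mem_image_of_mem _ (Finset.mem_univ i))]
      exact (hcode y hy).extend_apply w 0 i
    have hlift : ∀ f : TreeProd fun i => Set.Ici (s i), ∃ x, r 0 ≤ x ∧
        ∀ i, c.cls (C.tr (r 0) (r i) x) = f.1 i := by
      rintro ⟨f, α, hf⟩
      -- Heights inside the cones are relative to the `s i`, hence the shift by `height (r 0)`.
      have hz : ∀ i, height (c.out (f i)) = height (r 0) + α := fun i => by
        rw [c.height_out, height_ici, show height (f i) = α from hf i, ← c.height_out]
        exact congrArg (· + α) (hr i 0)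
      obtain ⟨x, hx, -, hx'⟩ := exists_common_lift C l hls hl (fun _ => p) (fun _ => c) (r 0) r
        (hr 0) hstep (height (r 0) + α) le_self_add (fun i => c.out (f i)) hz fun i => by
          have h1 : c.cls (r i) ≤ c.cls (c.out (f i)) := by
            rw [hcr, c.cls_out]; exact (f i).2
          obtain ⟨x', h2, h3⟩ := c.cls_le_cls.1 h1
          rwa [res_eq h2 ((c.height_eq h3).symm.trans (hr i 0))]
      exact ⟨x, hx, fun i => (c.cls_eq_iff.2 (hx' i)).trans (c.cls_out _)⟩
    choose g hg hgf using hlift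
    refine hS.ccc.of_reflects g fun f f' h => ?_
    have h1 : ∀ i, f.1 i ≤ f'.1 i := fun i => by
      rw [← Subtype.coe_le_coe, ← hgf f i, ← hgf f' i]
      exact c.cls_mono ((C.tr_le_tr_iff (hr 0 i) (hg f) (hg f')).2 h)
    exact h1

end CodedCongruence

end Free

end SouslinTree

/-! ### The decomposition -/

theorem mainTheorem1 (n : ℕ) (hn : 1 < n)
    (T : Type u) [PartialOrder T] [SouslinTree.IsTree T]
    (hnormal : SouslinTree.IsNormal T) (hsouslin : SouslinTree.IsSouslin T)
    (hbranching : SouslinTree.IsBranching T ℵ₀)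
    (hhom : SouslinTree.IsStronglyHomogeneous T) :
    ∃ (S : Fin n → Type u) (_ : ∀ m, PartialOrder (S m)) (_ : ∀ m, SouslinTree.IsTree (S m)),
      (∀ m, SouslinTree.IsNormal (S m) ∧ SouslinTree.IsSouslin (S m) ∧
        SouslinTree.IsBranching (S m) ℵ₀ ∧ SouslinTree.IsFree (S m)) ∧
      Nonempty (T ≃o SouslinTree.TreeProd S) := by
  open SouslinTree in
  obtain ⟨C⟩ := hhom
  have : Nontrivial (Fin n) := Fin.nontrivial_iff_two_le.2 hn
  obtain ⟨l, hli, hls, hl⟩ := exists_labelling C hbranching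
    (exists_gt hsouslin.height_eq hnormal)
  -- The fixed-point-free `σ` required by the matrix exists because `n > 1`.
  choose σ hσ using fun m : Fin n => exists_ne m
  obtain ⟨p, hpb, hpi⟩ := exists_optimal_matrix σ hσ
  let c : ∀ m, CodedCongruence C l (p m) := fun m =>
    (nonempty_codedCongruence hsouslin.ccc C l hl (p m)).some
  have hfree : ∀ m, IsFree (c m).Quo := fun m =>
    (c m).isFree_quo hnormal hsouslin hls hl (hpi m)
  have hsurj : ∀ m j, Function.Surjective (p m j) := fun m j i => by
    obtain ⟨a, ha⟩ := hpi m {j} fun _ => i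
    exact ⟨a, ha j (Finset.mem_singleton_self j)⟩
  have heq : ∀ x y, (∀ m, (c m).rel x y) → x = y :=
    eq_of_forall_rel hnormal C l hli p (fun j => (hpb j).injective) c
  refine ⟨fun m => (c m).Quo, fun m => inferInstance, fun m => inferInstance, fun m => ?_, ?_⟩
  · have hccc := (c m).isCCC_quo hsouslin.ccc
    exact ⟨(hfree m).normal, ⟨(hfree m).height_eq, hccc,
      countable_branch_of_isCCC (hfree m).height_eq (hfree m).normal hccc⟩,
      (c m).isBranching_quo hls (hsurj m), hfree m⟩
  · let F : T → TreeProd fun m => (c m).Quo := fun x =>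
      ⟨fun m => (c m).cls x, height x, fun m => (c m).height_cls x⟩
    have hF : ∀ x y, F x ≤ F y ↔ x ≤ y := by
      intro x y
      constructor
      · intro h
        have h1 : ∀ m, (c m).rel x (res y (height x)) := fun m => by
          obtain ⟨x', h2, h3⟩ := (c m).cls_le_cls.1 (h m)
          rwa [res_eq h2 ((c m).height_eq h3).symm]
        rw [heq x _ h1]
        exact res_le _ _
      · exact fun h m => (c m).cls_mono h
    have hsurjF : Function.Surjective F := by
      rintro ⟨f, α, hf⟩
      obtain ⟨t, ht⟩ : ∃ t : T, height t = 0 := by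
        obtain ⟨t, -, ht⟩ := exists_le_height_eq ((c (Classical.arbitrary _)).out (f _)) (zero_le)
        exact ⟨t, ht⟩
      have hz : ∀ m, height ((c m).out (f m)) = α := fun m => ((c m).height_out _).trans (hf m)
      -- Lifting starts at the root, where all translations are the identity; the successor step is
      -- that pieces from different rows meet.
      obtain ⟨x, hx, -, hx'⟩ := exists_common_lift C l hls hl p c t (fun _ => t) (fun _ => rfl)
        (fun y hy w => by
          simp only [C.tr_self hy]
          obtain ⟨a, ha⟩ := (hpb fun m => (c m).code y).surjective w
          exact ⟨a, congrFun ha⟩)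
        α (ht ▸ zero_le) (fun m => (c m).out (f m)) hz fun m => by
          have h1 : height (res ((c m).out (f m)) (height t)) = 0 := by
            rw [ht]; exact height_res (zero_le)
          rw [eq_of_height_eq_zero hnormal h1 ht]
          exact (c m).equiv.refl t
      refine ⟨x, Subtype.ext (funext fun m => ?_)⟩
      have h2 := hx' m
      rw [C.tr_self hx] at h2
      exact ((c m).cls_eq_iff.2 h2).trans ((c m).cls_out _)
    have hinj : Function.Injective F := fun x y h =>
      le_antisymm ((hF x y).1 h.le) ((hF y x).1 h.ge)
    exact ⟨⟨Equiv.ofBijective F ⟨hinj, hsurjF⟩, hF _ _⟩⟩
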